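/- Let $k$ be a field and let $H \subseteq \mathbb{N}$ be a numerical semigroup (a submonoid of $(\mathbb{N},+)$ with finite complement) with embedding dimension $n \ge 3$ and multiplicity $a = \min(H\setminus\{0\})$. Put $\ell = a - n + 1$ and assume $\ell \ge 2$. Let $k[H] = k[t^x \mid x \in H] \subseteq k[t]$, and assume that $k[H]/(t^{a})$ is a stretched Artinian local ring, i.e. the square of its maximal ideal is zero or principal. Let $\mathrm{PF}(H) = \{x \in \mathbb{Z}\setminus H \mid x + y \in H \text{ for all } 0 < y \in H\}$ be the set of pseudo-Frobenius numbers, and assume that $$\mathrm{PF}(H) = \{h+\alpha,\, h+2\alpha,\, \ldots,\, h+(n-1)\alpha\}$$ for some integers $h \ge 0$ and $\alpha > 0$. Put $b = \frac{h+(n-1)\alpha+a}{\ell}$ and assume that $b$ is an integer and that the minimal system of generators of $H$ is $$\{a, b\} \cup \{h+\alpha+a,\, h+2\alpha+a,\, \ldots,\, h+(n-1)\alpha+a\} \setminus \{h+(n-1)\alpha+a\}.$$ Then the following hold. 1. $b + \alpha \equiv 0 \pmod a$. 2. $h \equiv 0 \pmod a$. 3. With $h_1 = \frac{h}{a}$,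 one has $\frac{b+\alpha}{a} = \frac{h_1+1+\alpha}{\ell}$; in particular this number is an integer. 4. Let $a_1 = a$, $a_n = b$ and $a_i = h + (i-1)\alpha + a$ for $2 \le i \le n-1$, let $S = k[X_1, \ldots, X_n]$, and let $I_H$ be the kernel of the $k$-algebra homomorphism $S \to k[H]$, $X_i \mapsto t^{a_i}$. Then $$I_H = \mathrm{I}_2\begin{pmatrix} X_1^{h_1+1} & X_2 & \cdots & X_{n-1} & X_n \\ X_2 & X_3 & \cdots & X_n^{\ell} & X_1^{\frac{h_1+1+\alpha}{\ell}} \end{pmatrix},$$ where $\mathrm{I}_2(M)$ denotes the ideal of $S$ generated by the $2\times 2$ minors of the matrix $M$. -/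

import Mathlib

namespace NumSgp

/-- A numerical semigroup: a submonoid of `ℕ` with finite complement
(equivalently, generated by finitely many integers with greatest common divisor `1`). -/
def IsNumericalSemigroup (H : AddSubmonoid ℕ) : Prop :=
  ((H : Set ℕ)ᶜ).Finite

/-- The minimal system of generators of `H`: the nonzero elements of `H` which are not a sum of
two nonzero elements of `H`. See `minimal_closure_eq_iff` for the description as the minimal
generating set. -/
def minimalGenerators (H : AddSubmonoid ℕ) : Set ℕ :=
  {x | x ∈ H ∧ x ≠ 0 ∧ ∀ y ∈ H, ∀ z ∈ H, x = y + z → y = 0 ∨ z = 0}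

/-- The embedding dimension: the number of minimal generators. -/
noncomputable def embDim (H : AddSubmonoid ℕ) : ℕ :=
  (minimalGenerators H).ncard

/-- The multiplicity: the least nonzero element of `H`. -/
noncomputable def mult (H : AddSubmonoid ℕ) : ℕ :=
  sInf {x | x ∈ H ∧ x ≠ 0}

theorem mult_mem {H : AddSubmonoid ℕ} (hH : IsNumericalSemigroup H) : mult H ∈ H := by
  have hne : {x | x ∈ H ∧ x ≠ 0}.Nonempty := by
    by_contra hcon
    rw [Set.not_nonempty_iff_eq_empty] at hcon
    apply Set.infinite_univ (α := ℕ)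
    refine (hH.union (Set.finite_singleton 0)).subset fun x _ => ?_
    by_cases hx : x ∈ H
    · right
      by_contra h0
      have : x ∈ ({x | x ∈ H ∧ x ≠ 0} : Set ℕ) := ⟨hx, h0⟩
      rw [hcon] at this
      exact this
    · left
      exact hx
  exact (Nat.sInf_mem hne).1

theorem closure_minimalGenerators (H : AddSubmonoid ℕ) :
    AddSubmonoid.closure (minimalGenerators H) = H := by
  apply le_antisymm
  · rw [AddSubmonoid.closure_le]
    exact fun x hx => hx.1
  · intro x
    induction x using Nat.strong_induction_on with
    | _ x ih =>
      intro hx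
      by_cases h0 : x = 0
      · rw [h0]
        exact zero_mem _
      by_cases hg : x ∈ minimalGenerators H
      · exact AddSubmonoid.subset_closure hg
      · have : ∃ y ∈ H, ∃ z ∈ H, x = y + z ∧ y ≠ 0 ∧ z ≠ 0 := by
          by_contra hcon
          push Not at hcon
          refine hg ⟨hx, h0, fun y hy z hz hyz => ?_⟩
          by_cases hy0 : y = 0
          · exact Or.inl hy0
          · exact Or.inr (hcon y hy z hz hyz hy0)
        obtain ⟨y, hy, z, hz, rfl, hy0, hz0⟩ := this
        exact add_mem (ih y (by omega) hy) (ih z (by omega) hz)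

theorem minimalGenerators_subset {H : AddSubmonoid ℕ} {G : Set ℕ}
    (hG : AddSubmonoid.closure G = H) : minimalGenerators H ⊆ G := by
  intro x hx
  have key : ∀ y ∈ AddSubmonoid.closure G, y ∈ H ∧ (y ∈ minimalGenerators H → y ∈ G) := by
    intro y hy
    induction hy using AddSubmonoid.closure_induction with
    | mem y hy => exact ⟨hG ▸ AddSubmonoid.subset_closure hy, fun _ => hy⟩
    | zero => exact ⟨zero_mem H, fun h => absurd rfl h.2.1⟩
    | add y z _ _ ihy ihz =>
      refine ⟨add_mem ihy.1 ihz.1, fun h => ?_⟩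
      rcases h.2.2 y ihy.1 z ihz.1 rfl with h0 | h0
      · subst h0
        rw [zero_add] at h ⊢
        exact ihz.2 h
      · subst h0
        rw [add_zero] at h ⊢
        exact ihy.2 h
  exact (key x (hG ▸ hx.1)).2 hx

/-- `minimalGenerators H` is the unique generating set of `H` that is minimal for inclusion. -/
theorem minimal_closure_eq_iff (H : AddSubmonoid ℕ) (G : Set ℕ) :
    Minimal (fun G : Set ℕ => AddSubmonoid.closure G = H) G ↔ G = minimalGenerators H := by
  constructor
  · intro h
    exact Set.Subset.antisymm
      (h.2 (closure_minimalGenerators H) (minimalGenerators_subset h.1))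
      (minimalGenerators_subset h.1)
  · rintro rfl
    exact ⟨closure_minimalGenerators H, fun G' hG' _ => minimalGenerators_subset hG'⟩

/-- The set of pseudo-Frobenius numbers: the integers `x ∉ H` such that
`x + y ∈ H` for all `0 < y ∈ H`. -/
def PF (H : AddSubmonoid ℕ) : Set ℤ :=
  {x | x ∉ ((↑) : ℕ → ℤ) '' (H : Set ℕ) ∧
    ∀ y ∈ H, 0 < y → x + (y : ℤ) ∈ ((↑) : ℕ → ℤ) '' (H : Set ℕ)}

/-- The numerical semigroup ring `k[H] ⊆ k[t]`, generated by the powers `t ^ x`, `x ∈ H`. -/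
noncomputable def semigroupRing (k : Type*) [Field k] (H : AddSubmonoid ℕ) :
    Subalgebra k (Polynomial k) :=
  Algebra.adjoin k ((fun x : ℕ => (Polynomial.X : Polynomial k) ^ x) '' (H : Set ℕ))

/-- The element `t ^ x` of `k[H]`, for `x ∈ H`. -/
noncomputable def tPow (k : Type*) [Field k] (H : AddSubmonoid ℕ) (x : H) : semigroupRing k H :=
  ⟨(Polynomial.X : Polynomial k) ^ (x : ℕ), Algebra.subset_adjoin ⟨(x : ℕ), x.2, rfl⟩⟩

/-- A stretched Artinian local ring: the square of the maximal ideal is zero or principal. -/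
structure IsStretchedArtinianLocal (A : Type*) [CommRing A] : Prop where
  isArtinianRing : IsArtinianRing A
  isLocalRing : IsLocalRing A
  sq_maximalIdeal : IsLocalRing.maximalIdeal A ^ 2 = ⊥ ∨
    (IsLocalRing.maximalIdeal A ^ 2).IsPrincipal

/-- The defining ideal attached to a tuple `a` of positive integers: the kernel of the
`k`-algebra map `k[X_i] → k[t]`, `X_i ↦ t ^ (a i)`, whose image is `k[t ^ (a i)]`. -/
noncomputable def definingIdeal (k : Type*) [Field k] {n : ℕ} (a : Fin n → ℕ) :
    Ideal (MvPolynomial (Fin n) k) :=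
  RingHom.ker (MvPolynomial.aeval (R := k)
    (fun i => (Polynomial.X : Polynomial k) ^ a i)).toRingHom

/-- `I_r(M)`: the ideal generated by the `r × r` minors of `M`. -/
def minorsIdeal {R : Type*} [CommRing R] {m n : Type*} (r : ℕ) (M : Matrix m n R) : Ideal R :=
  Ideal.span (Set.range fun p : (Fin r ↪ m) × (Fin r ↪ n) => (M.submatrix p.1 p.2).det)

/-- The tuple with first entry `a`, last entry `b`, and `i`-th entry (counting from `1`)
`h + (i - 1) α + a` for `2 ≤ i ≤ n - 1`. -/
def genTuple (n a b h α : ℕ) : Fin n → ℕ := fun i =>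
  if (i : ℕ) = 0 then a
  else if (i : ℕ) = n - 1 then b
  else h + (i : ℕ) * α + a

/-- The `2 × n` matrix with rows `X_1 ^ q, X_2, …, X_n` and
`X_2, …, X_{n-1}, X_n ^ ℓ, X_1 ^ p` (in the code the variables are indexed from `0`). -/
noncomputable def relMatrix (k : Type*) [Field k] (n q ℓ p : ℕ) :
    Matrix (Fin 2) (Fin n) (MvPolynomial (Fin n) k) :=
  ![fun i => if (i : ℕ) = 0 then MvPolynomial.X i ^ q else MvPolynomial.X i,
    fun i =>
      if hi : (i : ℕ) + 1 < n then
        if (i : ℕ) + 2 = n then MvPolynomial.X ⟨(i : ℕ) + 1, hi⟩ ^ ℓ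
        else MvPolynomial.X ⟨(i : ℕ) + 1, hi⟩
      else MvPolynomial.X ⟨0, i.pos⟩ ^ p]

end NumSgp

/-! Everything rests on the Apéry set of `H` with respect to `a`, the elements `w` of `H` with `w -
a` outside `H`. Each `h + iα + a` belongs to it, because `h + iα` is pseudo-Frobenius, and nothing
nonzero can be added to it inside the Apéry set. Since `ℓb = h + (n-1)α + a`, the Apéry set consists
of the chain `0, b, …, ℓb` and the elements `h + iα + a` with `1 ≤ i ≤ n - 2` (`apery_cases`), all
distinct (`add_ne_mul_of_PF`).

Arithmetic: the Apéry element in the class of `(ℓ-1)b - α` modulo `a` can only be `ℓb`, as any other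
would make some `h + iα + a` equal to a multiple of `b` in a forbidden way. Hence `a` divides `b +
α` (`add_modEq_zero`). As `a = ℓ + n - 1`, the identity `ℓ(b + α) = h + a(1 + α)` then gives the
divisibility of `h` and the formula for the exponent.

Ideal: the lower row of the matrix has degrees exceeding those of the upper row by `α`, so the
minors vanish under `X_i ↦ t^(a_i)`. Conversely, modulo the minors every monomial is either `X_1`
times a monomial or one of the monomials that represent the Apéry set (`mk_monomial_cases`). The
latter are determined by their degree, so cancelling `X_1` and induction on the degree show that
monomials of equal degree are congruent, which is enough by `definingIdeal_le`. -/

namespace NumSgp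

open MvPolynomial

/-! ### The Apéry set and the congruence for `b + α` -/

section Semigroup

variable {H : AddSubmonoid ℕ} {n ℓ a h α b : ℕ}

/-- Two congruent elements of the Apéry set of `H` with respect to `a` are equal. -/
theorem apery_eq_of_modEq (ha : a ∈ H) {v w : ℕ} (hv : v ∈ H) (hw : w ∈ H)
    (hv' : ∀ y ∈ H, v ≠ y + a) (hw' : ∀ y ∈ H, w ≠ y + a) (hvw : v ≡ w [MOD a]) : v = w := by
  have key : ∀ v w : ℕ, v ∈ H → (∀ y ∈ H, w ≠ y + a) → v ≡ w [MOD a] → w ≤ v := by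
    intro v w hv hw' hvw
    by_contra! hlt
    obtain ⟨c, hc⟩ := (Nat.modEq_iff_dvd' hlt.le).1 hvw
    rcases c with _ | c
    · omega
    · refine hw' (v + c * a) (add_mem hv ?_) ?_
      · simpa using nsmul_mem ha c
      · rw [mul_comm, add_mul] at hc
        omega
  exact le_antisymm (key w v hw hv' hvw.symm) (key v w hv hw' hvw)

/-- Every residue class modulo `a` contains an element of the Apéry set. -/
theorem exists_apery_modEq (hH : IsNumericalSemigroup H) (ha : 0 < a) (r : ℕ) :
    ∃ w ∈ H, (∀ y ∈ H, w ≠ y + a) ∧ w ≡ r [MOD a] := by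
  have hex : ∃ w, w ∈ H ∧ w ≡ r [MOD a] := by
    obtain ⟨N, hN⟩ := hH.bddAbove
    refine ⟨r + (N + 1) * a, ?_, by simp [Nat.ModEq]⟩
    by_contra hcon
    have h1 : r + (N + 1) * a ≤ N := hN hcon
    have h2 : (N + 1) * 1 ≤ (N + 1) * a := Nat.mul_le_mul_left _ ha
    omega
  classical
  obtain ⟨h1, h2⟩ := Nat.find_spec hex
  refine ⟨Nat.find hex, h1, fun y hy hya => ?_, h2⟩
  refine Nat.find_min hex (m := y) (by omega) ⟨hy, ?_⟩
  rw [hya] at h2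
  simpa [Nat.ModEq] using h2

theorem not_mem_of_PF (hPF : PF H = (fun i : ℕ => ((h + i * α : ℕ) : ℤ)) '' Set.Icc 1 (n - 1))
    {i : ℕ} (h1 : 1 ≤ i) (h2 : i ≤ n - 1) : h + i * α ∉ H := by
  have : ((h + i * α : ℕ) : ℤ) ∈ PF H := hPF ▸ ⟨i, ⟨h1, h2⟩, rfl⟩
  exact fun hmem => this.1 ⟨_, hmem, rfl⟩

theorem add_mem_of_PF (hPF : PF H = (fun i : ℕ => ((h + i * α : ℕ) : ℤ)) '' Set.Icc 1 (n - 1))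
    {i : ℕ} (h1 : 1 ≤ i) (h2 : i ≤ n - 1) {y : ℕ} (hy : y ∈ H) (hy0 : 0 < y) :
    h + i * α + y ∈ H := by
  have : ((h + i * α : ℕ) : ℤ) ∈ PF H := hPF ▸ ⟨i, ⟨h1, h2⟩, rfl⟩
  obtain ⟨z, hz, hzy⟩ := this.2 y hy hy0
  have : z = h + i * α + y := by exact_mod_cast hzy
  exact this ▸ hz

/-- An element of `H` is either a translate by `a` or one of the explicit Apéry elements. -/
theorem apery_cases (hn : 3 ≤ n) (hℓ : 2 ≤ ℓ)
    (hPF : PF H = (fun i : ℕ => ((h + i * α : ℕ) : ℤ)) '' Set.Icc 1 (n - 1))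
    (hb : ℓ * b = h + (n - 1) * α + a)
    (hj : minimalGenerators H =
      {a, b} ∪ ((fun i : ℕ => h + i * α + a) '' Set.Icc 1 (n - 1) \ {h + (n - 1) * α + a}))
    (hbH : b ∈ H) {x : ℕ} (hx : x ∈ H) :
    (∃ y ∈ H, x = y + a) ∨ (∃ m ≤ ℓ, x = m * b) ∨
      ∃ i, 1 ≤ i ∧ i ≤ n - 2 ∧ x = h + i * α + a := by
  -- As `h + iα` is pseudo-Frobenius, adding a nonzero `x` to `h + iα + a` leaves the Apéry set.
  have hc : ∀ i x : ℕ, 1 ≤ i → i ≤ n - 1 → x ∈ H →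
      (∃ y ∈ H, h + i * α + a + x = y + a) ∨ x = 0 := by
    intro i x h1 h2 hx
    rcases Nat.eq_zero_or_pos x with h0 | h0
    · exact Or.inr h0
    · exact Or.inl ⟨_, add_mem_of_PF hPF h1 h2 hx h0, by ring⟩
  rw [← closure_minimalGenerators H] at hx
  induction hx using AddSubmonoid.closure_induction with
  | mem x hx =>
    rw [hj] at hx
    rcases hx with (rfl | rfl) | ⟨⟨i, ⟨h1, h2⟩, rfl⟩, hne⟩
    · exact Or.inl ⟨0, zero_mem _, by simp⟩
    · exact Or.inr (Or.inl ⟨1, by omega, by simp⟩)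
    · refine Or.inr (Or.inr ⟨i, h1, ?_, rfl⟩)
      have : i ≠ n - 1 := by
        rintro rfl
        exact hne rfl
      omega
  | zero => exact Or.inr (Or.inl ⟨0, by omega, by simp⟩)
  | add x y hx hy ihx ihy =>
    rw [closure_minimalGenerators] at hx hy
    rcases ihx with ⟨z, hz, rfl⟩ | ihx
    · exact Or.inl ⟨z + y, add_mem hz hy, by ring⟩
    rcases ihy with ⟨z, hz, rfl⟩ | ihy
    · exact Or.inl ⟨x + z, add_mem hx hz, by ring⟩
    rcases ihx with ⟨m, hm, rfl⟩ | ⟨i, h1, h2, rfl⟩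
    · rcases ihy with ⟨m', hm', rfl⟩ | ⟨i, h1, h2, rfl⟩
      · by_cases hle : m + m' ≤ ℓ
        · exact Or.inr (Or.inl ⟨m + m', hle, by ring⟩)
        -- Past `ℓ`, split off `ℓb = h + (n-1)α + a` and apply `hc` to the remainder.
        · have hmem : (m + m' - ℓ) * b ∈ H := by simpa using nsmul_mem hbH (m + m' - ℓ)
          have heq : m * b + m' * b = ℓ * b + (m + m' - ℓ) * b := by
            rw [← add_mul, ← add_mul]
            congr 1
            omega
          rcases hc (n - 1) _ (by omega) le_rfl hmem with ⟨z, hz, hz'⟩ | h0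
          · exact Or.inl ⟨z, hz, by rw [heq, hb, hz']⟩
          · exact Or.inr (Or.inl ⟨ℓ, le_rfl, by rw [heq, h0, add_zero]⟩)
      · rcases hc i _ h1 (by omega) hx with ⟨z, hz, hz'⟩ | h0
        · exact Or.inl ⟨z, hz, by rw [← hz', add_comm]⟩
        · exact Or.inr (Or.inr ⟨i, h1, h2, by rw [h0, zero_add]⟩)
    · rcases hc i _ h1 (by omega) hy with ⟨z, hz, hz'⟩ | h0
      · exact Or.inl ⟨z, hz, hz'⟩
      · exact Or.inr (Or.inr ⟨i, h1, h2, by rw [h0, add_zero]⟩)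

/-- A summand in `H` of an Apéry element is again Apéry: if `mb - a` were in `H`, adding `(ℓ-m)b`
would put `ℓb - a = h + (n-1)α` in `H`. -/
theorem mul_ne_add_of_PF (hn : 3 ≤ n)
    (hPF : PF H = (fun i : ℕ => ((h + i * α : ℕ) : ℤ)) '' Set.Icc 1 (n - 1))
    (hb : ℓ * b = h + (n - 1) * α + a) (hbH : b ∈ H) {m : ℕ} (hm : m ≤ ℓ) :
    ∀ y ∈ H, m * b ≠ y + a := by
  intro y hy hya
  refine not_mem_of_PF hPF (i := n - 1) (by omega) le_rfl ?_
  have hmem : (ℓ - m) * b ∈ H := by simpa using nsmul_mem hbH (ℓ - m)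
  have heq : ℓ * b = m * b + (ℓ - m) * b := by
    rw [← add_mul]
    congr 1
    omega
  have : h + (n - 1) * α = y + (ℓ - m) * b := by omega
  exact this ▸ add_mem hy hmem

theorem add_ne_add_of_PF
    (hPF : PF H = (fun i : ℕ => ((h + i * α : ℕ) : ℤ)) '' Set.Icc 1 (n - 1))
    {i : ℕ} (h1 : 1 ≤ i) (h2 : i ≤ n - 1) : ∀ y ∈ H, h + i * α + a ≠ y + a := by
  intro y hy hya
  exact not_mem_of_PF hPF h1 h2 (by rwa [Nat.add_right_cancel hya])

/-- The elements `h + i α + a` are maximal in the Apéry set, so no smaller multiple of `b` is one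
of them. -/
theorem add_ne_mul_of_PF (hn : 3 ≤ n) (hα : 0 < α) (hb0 : 0 < b)
    (hPF : PF H = (fun i : ℕ => ((h + i * α : ℕ) : ℤ)) '' Set.Icc 1 (n - 1))
    (hb : ℓ * b = h + (n - 1) * α + a) (hbH : b ∈ H) {m i : ℕ} (h1 : 1 ≤ i) (h2 : i ≤ n - 1)
    (hm : m ≤ ℓ) (hmi : m < ℓ ∨ i ≤ n - 2) : h + i * α + a ≠ m * b := by
  intro heq
  rcases hm.eq_or_lt with rfl | hlt
  · have h3 : i < n - 1 := by omega
    have := Nat.mul_lt_mul_of_pos_right h3 hα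
    omega
  -- Adding `(ℓ-m)b > 0` to the pseudo-Frobenius number `h + iα` would give `ℓb - a`, which is not
  -- in `H`.
  · have hmem : (ℓ - m) * b ∈ H := by simpa using nsmul_mem hbH (ℓ - m)
    refine mul_ne_add_of_PF hn hPF hb hbH le_rfl _
      (add_mem_of_PF hPF h1 h2 hmem (Nat.mul_pos (by omega) hb0)) ?_
    have : ℓ * b = m * b + (ℓ - m) * b := by
      rw [← add_mul]
      congr 1
      omega
    omega

/-- The Apéry representative `w` of `(ℓ-1)b - α` is located by elimination. Once it is `ℓb`,
cancelling `(ℓ-1)b` leaves the claim. -/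
theorem add_modEq_zero (hH : IsNumericalSemigroup H) (hn : 3 ≤ n) (hℓ : 2 ≤ ℓ) (hα : 0 < α)
    (ha : 0 < a) (hb0 : 0 < b) (haH : a ∈ H) (hbH : b ∈ H)
    (hcH : ∀ i, 1 ≤ i → i ≤ n - 1 → h + i * α + a ∈ H)
    (hPF : PF H = (fun i : ℕ => ((h + i * α : ℕ) : ℤ)) '' Set.Icc 1 (n - 1))
    (hb : ℓ * b = h + (n - 1) * α + a)
    (hj : minimalGenerators H =
      {a, b} ∪ ((fun i : ℕ => h + i * α + a) '' Set.Icc 1 (n - 1) \ {h + (n - 1) * α + a})) :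
    b + α ≡ 0 [MOD a] := by
  have hmb : ∀ m, m * b ∈ H := fun m => by simpa using nsmul_mem hbH m
  have hℓb : (ℓ - 1) * b + b = ℓ * b := by
    rw [← Nat.succ_mul]
    congr 1
    omega
  -- In `ℕ`, `(a-1)α` plays the role of `-α` modulo `a`.
  obtain ⟨w, hw, hwa, hmod⟩ := exists_apery_modEq hH ha ((ℓ - 1) * b + (a - 1) * α)
  have hmod' : w + α ≡ (ℓ - 1) * b [MOD a] := by
    have h1 := hmod.add_right α
    have h2 : (ℓ - 1) * b + (a - 1) * α + α = (ℓ - 1) * b + a * α := by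
      rw [add_assoc, ← Nat.succ_mul]
      congr 2
      omega
    rw [h2] at h1
    simpa [Nat.ModEq] using h1
  rcases apery_cases hn hℓ hPF hb hj hbH hw with ⟨y, hy, hya⟩ | ⟨m, hm, rfl⟩ | ⟨i, h1, h2, rfl⟩
  · exact absurd hya (hwa y hy)
  · rcases hm.eq_or_lt with rfl | hlt
    · rw [← hℓb, add_assoc] at hmod'
      exact Nat.ModEq.add_left_cancel' ((m - 1) * b) hmod'
    -- If `w = mb` with `m < ℓ`, adding `b` gives `(m+1)b + α ≡ ℓb`, so `(m+1)b` and `h + (n-2)α +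
    -- a` are congruent Apéry elements, hence equal.
    · exfalso
      refine add_ne_mul_of_PF hn hα hb0 hPF hb hbH (i := n - 2) (m := m + 1) (by omega) (by omega)
        hlt (Or.inr le_rfl) ?_
      refine apery_eq_of_modEq haH (hcH _ (by omega) (by omega)) (hmb _)
        (add_ne_add_of_PF hPF (by omega) (by omega)) (mul_ne_add_of_PF hn hPF hb hbH hlt) ?_
      refine Nat.ModEq.add_right_cancel' α ?_
      have h3 : h + (n - 2) * α + a + α = ℓ * b := by
        have : (n - 1) * α = (n - 2) * α + α := by
          rw [← Nat.succ_mul]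
          congr 1
          omega
        omega
      rw [h3, ← hℓb, Nat.succ_mul]
      have := (hmod'.symm.add_right b)
      rwa [show m * b + α + b = m * b + b + α by ring] at this
  -- If `w = h + iα + a`, then `w + α` is the next term of the progression and is congruent to
  -- `(ℓ-1)b`. Both are Apéry, hence equal, against the maximality of `w + α`.
  · exfalso
    have h3 : h + i * α + a + α = h + (i + 1) * α + a := by ring
    rw [h3] at hmod'
    exact add_ne_mul_of_PF hn hα hb0 hPF hb hbH (i := i + 1) (m := ℓ - 1) (by omega) (by omega)
      (by omega) (Or.inl (by omega))
      (apery_eq_of_modEq haH (hcH _ (by omega) (by omega)) (hmb _)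
        (add_ne_add_of_PF hPF (by omega) (by omega))
        (mul_ne_add_of_PF hn hPF hb hbH (by omega)) hmod')

end Semigroup

/-! ### Degrees of monomials, kernels and minors -/

section Ideal

variable {k : Type*} [Field k] {n : ℕ}

/-- The weighted degree of an exponent vector. -/
def wdeg (w : Fin n → ℕ) (u : Fin n →₀ ℕ) : ℕ := ∑ i, u i * w i

theorem wdeg_add (w : Fin n → ℕ) (u v : Fin n →₀ ℕ) : wdeg w (u + v) = wdeg w u + wdeg w v := by
  simp [wdeg, add_mul, Finset.sum_add_distrib]

theorem wdeg_single (w : Fin n → ℕ) (i : Fin n) (m : ℕ) :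
    wdeg w (Finsupp.single i m) = m * w i := by
  classical
  simp [wdeg, Finsupp.single_apply, ite_mul]

theorem wdeg_mem {H : AddSubmonoid ℕ} {w : Fin n → ℕ} (hw : ∀ i, w i ∈ H) (u : Fin n →₀ ℕ) :
    wdeg w u ∈ H :=
  sum_mem fun i _ => by simpa using nsmul_mem (hw i) (u i)

theorem aeval_monomial_pow (w : Fin n → ℕ) (u : Fin n →₀ ℕ) (c : k) :
    aeval (R := k) (fun i => (Polynomial.X : Polynomial k) ^ w i) (monomial u c) =
      Polynomial.monomial (wdeg w u) c := by
  rw [aeval_monomial, Finsupp.prod_fintype _ _ (by simp), ← Polynomial.C_mul_X_pow_eq_monomial]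
  simp only [← pow_mul, Finset.prod_pow_eq_pow_sum, wdeg]
  simp [mul_comm]

/-- If all monomials of equal weighted degree are congruent modulo `I`, then `I` contains the
defining ideal. -/
theorem definingIdeal_le (w : Fin n → ℕ) (I : Ideal (MvPolynomial (Fin n) k))
    (hI : ∀ u v, wdeg w u = wdeg w v →
      Ideal.Quotient.mk I (monomial u 1) = Ideal.Quotient.mk I (monomial v 1)) :
    definingIdeal k w ≤ I := by
  classical
  let rep : ℕ → (Fin n →₀ ℕ) := fun d => if hd : ∃ u, wdeg w u = d then hd.choose else 0
  have hrep : ∀ u, wdeg w (rep (wdeg w u)) = wdeg w u := by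
    intro u
    have hd : ∃ v, wdeg w v = wdeg w u := ⟨u, rfl⟩
    simp only [rep, dif_pos hd]
    exact hd.choose_spec
  -- `φ` sends `t^d` to the class of a chosen monomial of degree `d`. By `hI` the choice does not
  -- matter, so the quotient map factors through the evaluation and kills its kernel. The default
  -- value of `rep` at unattained degrees plays no role.
  let φ : Polynomial k →ₗ[k] (MvPolynomial (Fin n) k ⧸ I) :=
    (Polynomial.basisMonomials k).constr k fun d => Ideal.Quotient.mk I (monomial (rep d) 1)
  have hφ : φ ∘ₗ (aeval (R := k) (fun i => (Polynomial.X : Polynomial k) ^ w i)).toLinearMap =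
      (Ideal.Quotient.mkₐ k I).toLinearMap := by
    refine MvPolynomial.basisMonomials (Fin n) k |>.ext fun u => ?_
    simp only [coe_basisMonomials, LinearMap.comp_apply, AlgHom.toLinearMap_apply,
      aeval_monomial_pow, Ideal.Quotient.mkₐ_eq_mk]
    have := (Polynomial.basisMonomials k).constr_basis k
      (fun d => Ideal.Quotient.mk I (monomial (rep d) 1)) (wdeg w u)
    rw [Polynomial.coe_basisMonomials] at this
    exact this.trans (hI _ _ (hrep u))
  intro f hf
  have hf0 : aeval (R := k) (fun i => (Polynomial.X : Polynomial k) ^ w i) f = 0 := hf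
  have := LinearMap.congr_fun hφ f
  simp only [LinearMap.comp_apply, AlgHom.toLinearMap_apply, hf0, map_zero,
    Ideal.Quotient.mkₐ_eq_mk] at this
  exact Ideal.Quotient.eq_zero_iff_mem.1 this.symm

theorem mul_sub_mul_mem_minorsIdeal {R m : Type*} [CommRing R] (M : Matrix (Fin 2) m R) (i j : m) :
    M 0 i * M 1 j - M 0 j * M 1 i ∈ minorsIdeal 2 M := by
  by_cases hij : i = j
  · simp [hij]
  · refine Ideal.subset_span ⟨(Function.Embedding.refl _, ⟨![i, j], ?_⟩), ?_⟩
    · intro x y hxy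
      fin_cases x <;> fin_cases y <;> simp_all [eq_comm]
    · simp only [Matrix.det_fin_two, Matrix.submatrix_apply, Function.Embedding.refl_apply]
      rfl

/-- A monomial matrix whose rows differ by a constant degree has its minors in the kernel. -/
theorem minorsIdeal_le_ker {R m : Type*} [CommRing R] (M : Matrix (Fin 2) m R)
    (f : R →+* Polynomial k) (e : m → ℕ) (d : ℕ) (h0 : ∀ i, f (M 0 i) = Polynomial.X ^ e i)
    (h1 : ∀ i, f (M 1 i) = Polynomial.X ^ (e i + d)) : minorsIdeal 2 M ≤ RingHom.ker f := by
  -- The exponent is a sum of a row term and a column term, so the two products in a minor have the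
  -- same image.
  have hM : ∀ r i, f (M r i) = Polynomial.X ^ (e i) * Polynomial.X ^ ((r : ℕ) * d) := by
    intro r i
    fin_cases r
    · simp [h0]
    · simp [h1, pow_add]
  rw [minorsIdeal, Ideal.span_le]
  rintro _ ⟨p, rfl⟩
  simp only [SetLike.mem_coe, RingHom.mem_ker, Matrix.det_fin_two, Matrix.submatrix_apply, map_sub,
    map_mul, hM]
  ring

/-! ### Reducing monomials modulo the minors -/

section relMatrix

variable {q ℓ p : ℕ}

theorem relMatrix_zero_of_pos {i : Fin n} (hi : (i : ℕ) ≠ 0) :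
    relMatrix k n q ℓ p 0 i = X i := by
  simp [relMatrix, hi]

theorem relMatrix_zero_zero (hn : 0 < n) :
    relMatrix k n q ℓ p 0 ⟨0, hn⟩ = X ⟨0, hn⟩ ^ q := by
  simp [relMatrix]

theorem relMatrix_one_of_lt {i : ℕ} (hi : i + 2 < n) :
    relMatrix k n q ℓ p 1 ⟨i, by omega⟩ = X ⟨i + 1, by omega⟩ := by
  have h1 : i + 1 < n := by omega
  have h2 : i + 2 ≠ n := by omega
  simp [relMatrix, h1, h2]

theorem relMatrix_one_of_eq {i : ℕ} (hi : i + 2 = n) :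
    relMatrix k n q ℓ p 1 ⟨i, by omega⟩ = X ⟨i + 1, by omega⟩ ^ ℓ := by
  have h1 : i + 1 < n := by omega
  simp [relMatrix, h1, hi]

theorem relMatrix_one_last {i : ℕ} (hi : i + 1 = n) :
    relMatrix k n q ℓ p 1 ⟨i, by omega⟩ = X ⟨0, by omega⟩ ^ p := by
  simp [relMatrix, hi]

/-- The classes of monomials modulo `I`. -/
noncomputable def monomialClasses (I : Ideal (MvPolynomial (Fin n) k)) :
    Submonoid (MvPolynomial (Fin n) k ⧸ I) :=
  MonoidHom.mrange (((Ideal.Quotient.mk I : _ →+* _) : _ →* _).comp (monomialOneHom k (Fin n)))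

theorem mem_monomialClasses {I : Ideal (MvPolynomial (Fin n) k)}
    {x : MvPolynomial (Fin n) k ⧸ I} :
    x ∈ monomialClasses I ↔ ∃ u, Ideal.Quotient.mk I (monomial u 1) = x :=
  ⟨fun ⟨u, hu⟩ => ⟨u.toAdd, hu⟩, fun ⟨u, hu⟩ => ⟨Multiplicative.ofAdd u, hu⟩⟩

theorem mk_X_mem_monomialClasses (I : Ideal (MvPolynomial (Fin n) k)) (i : Fin n) :
    Ideal.Quotient.mk I (X i) ∈ monomialClasses I :=
  mem_monomialClasses.2 ⟨Finsupp.single i 1, rfl⟩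

/-- Cofactors are kept among classes of monomials, since the later induction on the degree needs an
actual monomial as quotient by `X 0`. -/
theorem dvd_class_mul {I : Ideal (MvPolynomial (Fin n) k)}
    {x y z : MvPolynomial (Fin n) k ⧸ I} (hz : z ∈ monomialClasses I)
    (h : ∃ v ∈ monomialClasses I, y = x * v) : ∃ v ∈ monomialClasses I, y * z = x * v := by
  obtain ⟨v, hv, rfl⟩ := h
  exact ⟨v * z, mul_mem hv hz, mul_assoc _ _ _⟩

theorem dvd_class_pow {I : Ideal (MvPolynomial (Fin n) k)}
    {x : MvPolynomial (Fin n) k ⧸ I} (hx : x ∈ monomialClasses I) {m : ℕ} (hm : m ≠ 0) :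
    ∃ v ∈ monomialClasses I, x ^ m = x * v :=
  ⟨x ^ (m - 1), pow_mem hx _, (mul_pow_sub_one hm x).symm⟩

theorem mk_relMatrix_mul (i j : Fin n) :
    Ideal.Quotient.mk (minorsIdeal 2 (relMatrix k n q ℓ p)) (relMatrix k n q ℓ p 1 i) *
      Ideal.Quotient.mk (minorsIdeal 2 (relMatrix k n q ℓ p)) (relMatrix k n q ℓ p 0 j) =
    Ideal.Quotient.mk (minorsIdeal 2 (relMatrix k n q ℓ p)) (relMatrix k n q ℓ p 0 i) *
      Ideal.Quotient.mk (minorsIdeal 2 (relMatrix k n q ℓ p)) (relMatrix k n q ℓ p 1 j) := by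
  rw [← map_mul, ← map_mul, eq_comm, Ideal.Quotient.eq]
  have := mul_sub_mul_mem_minorsIdeal (relMatrix k n q ℓ p) i j
  rwa [mul_comm (relMatrix k n q ℓ p 1 i)]

theorem mk_relMatrix_one_mem (j : Fin n) :
    Ideal.Quotient.mk (minorsIdeal 2 (relMatrix k n q ℓ p)) (relMatrix k n q ℓ p 1 j) ∈
      monomialClasses (minorsIdeal 2 (relMatrix k n q ℓ p)) := by
  obtain ⟨j, hj⟩ := j
  rcases lt_trichotomy (j + 2) n with h | h | h
  · rw [relMatrix_one_of_lt h]
    exact mk_X_mem_monomialClasses _ _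
  · rw [relMatrix_one_of_eq h, map_pow]
    exact pow_mem (mk_X_mem_monomialClasses _ _) _
  · rw [relMatrix_one_last (by omega), map_pow]
    exact pow_mem (mk_X_mem_monomialClasses _ _) _

/-- Modulo the minors, a product of two variables other than `X 0`, not both the last one, is
a monomial multiple of `X 0`. -/
theorem mk_X_mul_X (hℓ : ℓ ≠ 0) (hq : q ≠ 0) (hp : p ≠ 0) (i : ℕ) (hi : i + 2 < n) (j : ℕ)
    (hj0 : 1 ≤ j) (hj : j < n) :
    ∃ v ∈ monomialClasses (minorsIdeal 2 (relMatrix k n q ℓ p)),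
      Ideal.Quotient.mk (minorsIdeal 2 (relMatrix k n q ℓ p)) (X ⟨i + 1, by omega⟩) *
        Ideal.Quotient.mk (minorsIdeal 2 (relMatrix k n q ℓ p)) (X ⟨j, hj⟩) =
      Ideal.Quotient.mk (minorsIdeal 2 (relMatrix k n q ℓ p)) (X ⟨0, by omega⟩) * v := by
  -- The minor on columns `i` and `j` lowers the first index by one and moves the second factor to
  -- the lower row, raising its index. The walk stops when the first factor becomes `X 0 ^ q` or the
  -- second becomes `X 0 ^ p`.
  induction i generalizing j with
  | zero =>
    have := mk_relMatrix_mul (k := k) (n := n) (q := q) (ℓ := ℓ) (p := p) ⟨0, by omega⟩ ⟨j, hj⟩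
    rw [relMatrix_one_of_lt hi, relMatrix_zero_of_pos (by simp; omega), relMatrix_zero_zero,
      map_pow] at this
    rw [this]
    exact dvd_class_mul (mk_relMatrix_one_mem _) (dvd_class_pow (mk_X_mem_monomialClasses _ _) hq)
  | succ i ih =>
    have := mk_relMatrix_mul (k := k) (n := n) (q := q) (ℓ := ℓ) (p := p)
      ⟨i + 1, by omega⟩ ⟨j, hj⟩
    rw [relMatrix_one_of_lt hi, relMatrix_zero_of_pos (by simp; omega),
      relMatrix_zero_of_pos (by simp)] at this
    rw [this]
    rcases lt_trichotomy (j + 2) n with h | h | h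
    · rw [relMatrix_one_of_lt h]
      exact ih (by omega) (j + 1) (by omega) (by omega)
    -- The lower entry is now a power of the last variable: one factor continues the walk and the
    -- others go into the cofactor.
    · rw [relMatrix_one_of_eq h, map_pow, ← mul_pow_sub_one hℓ, ← mul_assoc]
      exact dvd_class_mul (pow_mem (mk_X_mem_monomialClasses _ _) _)
        (ih (by omega) (j + 1) (by omega) (by omega))
    · rw [relMatrix_one_last (by omega), map_pow, mul_comm]
      exact dvd_class_mul (mk_X_mem_monomialClasses _ _)
        (dvd_class_pow (mk_X_mem_monomialClasses _ _) hp)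

/-- The minor on the last two columns trades the power for the product of `X 0 ^ p` and the
next-to-last variable. -/
theorem mk_X_last_pow (hn : 3 ≤ n) (hp : p ≠ 0) :
    ∃ v ∈ monomialClasses (minorsIdeal 2 (relMatrix k n q ℓ p)),
      Ideal.Quotient.mk (minorsIdeal 2 (relMatrix k n q ℓ p)) (X ⟨n - 1, by omega⟩) ^ (ℓ + 1) =
      Ideal.Quotient.mk (minorsIdeal 2 (relMatrix k n q ℓ p)) (X ⟨0, by omega⟩) * v := by
  obtain ⟨n, rfl⟩ : ∃ r, n = r + 2 := ⟨n - 2, by omega⟩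
  have := mk_relMatrix_mul (k := k) (n := n + 2) (q := q) (ℓ := ℓ) (p := p)
    ⟨n, by omega⟩ ⟨n + 1, by omega⟩
  rw [relMatrix_one_of_eq rfl, relMatrix_one_last rfl, relMatrix_zero_of_pos (by simp),
    relMatrix_zero_of_pos (by simp; omega), map_pow, map_pow, ← pow_succ] at this
  simp only [show n + 2 - 1 = n + 1 from rfl]
  rw [this, mul_comm]
  exact dvd_class_mul (mk_X_mem_monomialClasses _ _)
    (dvd_class_pow (mk_X_mem_monomialClasses _ _) hp)

/-- Modulo the minors, a monomial is either a monomial multiple of `X 0`, or one of the monomials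
representing the Apéry set. -/
theorem mk_monomial_cases (hn : 3 ≤ n) (hℓ : ℓ ≠ 0) (hq : q ≠ 0) (hp : p ≠ 0)
    (u : Fin n →₀ ℕ) :
    (∃ v, Ideal.Quotient.mk (minorsIdeal 2 (relMatrix k n q ℓ p)) (monomial u 1) =
      Ideal.Quotient.mk (minorsIdeal 2 (relMatrix k n q ℓ p))
        (monomial (Finsupp.single ⟨0, by omega⟩ 1 + v) 1)) ∨
    (∃ m ≤ ℓ, u = Finsupp.single ⟨n - 1, by omega⟩ m) ∨
    ∃ i : Fin n, 1 ≤ (i : ℕ) ∧ (i : ℕ) ≤ n - 2 ∧ u = Finsupp.single i 1 := by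
  set I := minorsIdeal 2 (relMatrix k n q ℓ p) with hI
  have hmul : ∀ s t : Fin n →₀ ℕ, Ideal.Quotient.mk I (monomial (s + t) 1) =
      Ideal.Quotient.mk I (monomial s 1) * Ideal.Quotient.mk I (monomial t 1) := by
    intro s t
    rw [← map_mul, monomial_mul, one_mul]
  have conv : ∀ s t : Fin n →₀ ℕ, u = s + t →
      (∃ v ∈ monomialClasses I, Ideal.Quotient.mk I (monomial s 1) =
        Ideal.Quotient.mk I (X ⟨0, by omega⟩) * v) →
      ∃ v, Ideal.Quotient.mk I (monomial u 1) =
        Ideal.Quotient.mk I (monomial (Finsupp.single ⟨0, by omega⟩ 1 + v) 1) := by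
    rintro s t rfl hs
    obtain ⟨v, hv, hv'⟩ := dvd_class_mul (mem_monomialClasses.2 ⟨t, rfl⟩) hs
    obtain ⟨v, rfl⟩ := mem_monomialClasses.1 hv
    refine ⟨v, ?_⟩
    rw [hmul, hmul, hv']
    rfl
  have split : ∀ (s : Fin n →₀ ℕ) (i : Fin n) (m : ℕ), m ≤ s i →
      ∃ t, s = Finsupp.single i m + t := by
    intro s i m hm
    exact ⟨s - Finsupp.single i m, (add_tsub_cancel_of_le (Finsupp.single_le_iff.2 hm)).symm⟩
  have hX0 : ∀ t : Fin n →₀ ℕ, u = Finsupp.single ⟨0, by omega⟩ 1 + t → ∃ v,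
      Ideal.Quotient.mk I (monomial u 1) =
        Ideal.Quotient.mk I (monomial (Finsupp.single ⟨0, by omega⟩ 1 + v) 1) := by
    rintro t rfl
    exact ⟨t, rfl⟩
  by_cases hmid : ∃ i : Fin n, 1 ≤ (i : ℕ) ∧ (i : ℕ) ≤ n - 2 ∧ u i ≠ 0
  · obtain ⟨i, hi1, hi2, hi⟩ := hmid
    obtain ⟨t, rfl⟩ := split u i 1 (Nat.one_le_iff_ne_zero.2 hi)
    by_cases ht : t = 0
    · exact Or.inr (Or.inr ⟨i, hi1, hi2, by rw [ht, add_zero]⟩)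
    · left
      obtain ⟨j, hj⟩ := Finsupp.ne_iff.1 ht
      obtain ⟨s, rfl⟩ := split t j 1 (Nat.one_le_iff_ne_zero.2 hj)
      by_cases hj0 : (j : ℕ) = 0
      · have hj' : j = ⟨0, by omega⟩ := Fin.ext hj0
        exact hX0 (Finsupp.single i 1 + s) (by rw [← hj']; abel)
      · refine conv (Finsupp.single i 1 + Finsupp.single j 1) s (by abel) ?_
        rw [hmul]
        obtain ⟨i, hi'⟩ := i
        obtain ⟨i, rfl⟩ : ∃ r, i = r + 1 := ⟨i - 1, by simp at hi1; omega⟩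
        exact mk_X_mul_X hℓ hq hp i (by simp at hi2; omega) j (by omega) j.2
  · push Not at hmid
    by_cases h0 : u ⟨0, by omega⟩ = 0
    · have hu : u = Finsupp.single ⟨n - 1, by omega⟩ (u ⟨n - 1, by omega⟩) := by
        ext i
        by_cases hi : i = ⟨n - 1, by omega⟩
        · subst hi
          simp
        · rw [Finsupp.single_eq_of_ne hi]
          by_cases hi0 : i = ⟨0, by omega⟩
          · rw [hi0, h0]
          · have h1 : (i : ℕ) ≠ n - 1 := fun h => hi (Fin.ext h)
            have h2 : (i : ℕ) ≠ 0 := fun h => hi0 (Fin.ext h)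
            exact hmid i (by omega) (by omega)
      by_cases hle : u ⟨n - 1, by omega⟩ ≤ ℓ
      · exact Or.inr (Or.inl ⟨_, hle, hu⟩)
      · left
        obtain ⟨t, ht⟩ := split u ⟨n - 1, by omega⟩ (ℓ + 1) (by omega)
        refine conv _ t ht ?_
        have := mk_X_last_pow (k := k) (q := q) (ℓ := ℓ) hn hp
        rw [← map_pow, X_pow_eq_monomial] at this
        exact this
    · obtain ⟨t, ht⟩ := split u ⟨0, by omega⟩ 1 (Nat.one_le_iff_ne_zero.2 h0)
      exact Or.inl (hX0 t ht)

/-! ### The two inclusions between the defining ideal and the ideal of minors -/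

variable {a b h α : ℕ}

theorem minorsIdeal_relMatrix_le (hn : 3 ≤ n) (hb : ℓ * b = h + (n - 1) * α + a)
    (hq : q * a = h + a) (hp : p * a = b + α) :
    minorsIdeal 2 (relMatrix k n q ℓ p) ≤ definingIdeal k (genTuple n a b h α) := by
  -- The upper row has the degrees of the variables, except that its first entry `X 0 ^ q` has
  -- degree `qa = h + a`. This makes the row difference `α` in the first column too.
  refine minorsIdeal_le_ker _ _
    (fun i => if (i : ℕ) = 0 then h + a else genTuple n a b h α i) α ?_ ?_
  · rintro ⟨i, hi⟩
    by_cases h0 : i = 0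
    · subst h0
      rw [relMatrix_zero_zero]
      simp [genTuple, ← pow_mul, ← hq, mul_comm]
    · rw [relMatrix_zero_of_pos h0]
      simp [h0]
  · rintro ⟨i, hi⟩
    rcases lt_trichotomy (i + 2) n with h' | h' | h'
    · rw [relMatrix_one_of_lt h']
      have h1 : i + 1 ≠ n - 1 := by omega
      have h2 : i ≠ n - 1 := by omega
      simp only [AlgHom.toRingHom_eq_coe, RingHom.coe_coe, aeval_X, genTuple, h1, h2,
        Nat.add_eq_zero_iff, one_ne_zero, and_false, if_false]
      congr 1
      split_ifs with h3
      · subst h3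
        ring
      · ring
    · rw [relMatrix_one_of_eq h']
      have h1 : i + 1 = n - 1 := by omega
      have h2 : i ≠ n - 1 := by omega
      have h3 : i ≠ 0 := by omega
      simp only [AlgHom.toRingHom_eq_coe, RingHom.coe_coe, map_pow, aeval_X, genTuple, h1, h2, h3,
        if_false, if_true, ← pow_mul, show n - 1 ≠ 0 by omega]
      congr 1
      rw [mul_comm, hb, ← h1]
      ring
    · rw [relMatrix_one_last (by omega)]
      have h2 : i = n - 1 := by omega
      have h3 : n - 1 ≠ 0 := by omega
      simp only [AlgHom.toRingHom_eq_coe, RingHom.coe_coe, map_pow, aeval_X, genTuple, h2, h3,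
        if_false, if_true, ← pow_mul]
      rw [mul_comm, hp]

theorem definingIdeal_le_minorsIdeal {H : AddSubmonoid ℕ} (hn : 3 ≤ n) (hα : 0 < α) (hℓ : ℓ ≠ 0)
    (ha : 0 < a) (hb0 : 0 < b) (haH : a ∈ H) (hbH : b ∈ H)
    (hcH : ∀ i, 1 ≤ i → i ≤ n - 1 → h + i * α + a ∈ H)
    (hPF : PF H = (fun i : ℕ => ((h + i * α : ℕ) : ℤ)) '' Set.Icc 1 (n - 1))
    (hb : ℓ * b = h + (n - 1) * α + a)
    (hq : q * a = h + a) (hp : p * a = b + α) :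
    definingIdeal k (genTuple n a b h α) ≤ minorsIdeal 2 (relMatrix k n q ℓ p) := by
  have hle := minorsIdeal_relMatrix_le (k := k) hn hb hq hp
  have hq0 : q ≠ 0 := by
    rintro rfl
    omega
  have hp0 : p ≠ 0 := by
    rintro rfl
    omega
  set w := genTuple n a b h α with hw
  have hw0 : w ⟨0, by omega⟩ = a := by simp [hw, genTuple]
  have hwl : w ⟨n - 1, by omega⟩ = b := by simp [hw, genTuple, show n - 1 ≠ 0 by omega]
  have hwi : ∀ i : Fin n, 1 ≤ (i : ℕ) → (i : ℕ) ≤ n - 2 → w i = h + (i : ℕ) * α + a := by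
    intro i h1 h2
    have h3 : (i : ℕ) ≠ 0 := by omega
    have h4 : (i : ℕ) ≠ n - 1 := by omega
    simp only [hw, genTuple, h3, h4, if_false]
  have hwH : ∀ i, w i ∈ H := by
    intro i
    by_cases h0 : i = ⟨0, by omega⟩
    · rw [h0, hw0]
      exact haH
    by_cases hl : i = ⟨n - 1, by omega⟩
    · rw [hl, hwl]
      exact hbH
    have h1 : (i : ℕ) ≠ n - 1 := fun h => hl (Fin.ext h)
    have h2 : (i : ℕ) ≠ 0 := fun h => h0 (Fin.ext h)
    rw [hwi i (by omega) (by omega)]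
    exact hcH _ (by omega) (by omega)
  have hdeg : ∀ u v, Ideal.Quotient.mk (minorsIdeal 2 (relMatrix k n q ℓ p)) (monomial u 1) =
      Ideal.Quotient.mk (minorsIdeal 2 (relMatrix k n q ℓ p)) (monomial v 1) →
      wdeg w u = wdeg w v := by
    intro u v huv
    have h1 := hle (Ideal.Quotient.eq.1 huv)
    have h2 : aeval (R := k) (fun i => (Polynomial.X : Polynomial k) ^ w i)
      (monomial u 1 - monomial v 1) = 0 := h1
    rw [map_sub, aeval_monomial_pow, aeval_monomial_pow, sub_eq_zero] at h2
    exact (Polynomial.monomial_eq_monomial_iff.1 h2).resolve_right (by simp) |>.1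
  -- the remaining monomials are determined by their degree, which lies in the Apéry set
  have hap : ∀ u : Fin n →₀ ℕ, ((∃ m ≤ ℓ, u = Finsupp.single ⟨n - 1, by omega⟩ m) ∨
      ∃ i : Fin n, 1 ≤ (i : ℕ) ∧ (i : ℕ) ≤ n - 2 ∧ u = Finsupp.single i 1) →
      ∀ v, wdeg w u ≠ wdeg w (Finsupp.single ⟨0, by omega⟩ 1 + v) := by
    intro u hu v
    rw [wdeg_add, wdeg_single, hw0, one_mul, add_comm]
    rcases hu with ⟨m, hm, rfl⟩ | ⟨i, h1, h2, rfl⟩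
    · rw [wdeg_single, hwl]
      exact mul_ne_add_of_PF hn hPF hb hbH hm _ (wdeg_mem hwH v)
    · rw [wdeg_single, hwi i h1 h2, one_mul]
      exact add_ne_add_of_PF hPF h1 (by omega) _ (wdeg_mem hwH v)
  refine definingIdeal_le w _ fun u v huv => ?_
  obtain ⟨d, hd⟩ : ∃ d, wdeg w u = d := ⟨_, rfl⟩
  induction d using Nat.strong_induction_on generalizing u v with
  | _ d ih =>
    rcases mk_monomial_cases (k := k) hn hℓ hq0 hp0 u with ⟨u', hu⟩ | hu
    · rcases mk_monomial_cases (k := k) hn hℓ hq0 hp0 v with ⟨v', hv⟩ | hv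
      · have h1 := hdeg _ _ hu
        have h2 := hdeg _ _ hv
        -- Removing `X 0` lowers both degrees by `a > 0`, so the induction hypothesis applies to the
        -- cofactors.
        rw [wdeg_add, wdeg_single, hw0] at h1 h2
        have h3 := ih (wdeg w u') (by omega) u' v' (by omega) rfl
        rw [hu, hv, ← one_mul (1 : k), ← monomial_mul, ← monomial_mul, map_mul, map_mul, h3]
      · exact absurd (huv.symm.trans (hdeg _ _ hu)) (hap v hv u')
    · rcases mk_monomial_cases (k := k) hn hℓ hq0 hp0 v with ⟨v', hv⟩ | hv
      · exact absurd (huv.trans (hdeg _ _ hv)) (hap u hu v')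
      -- Both monomials represent Apéry elements, so equal degrees force equal exponent vectors.
      · congr 2
        rcases hu with ⟨m, hm, rfl⟩ | ⟨i, h1, h2, rfl⟩ <;>
          rcases hv with ⟨m', hm', rfl⟩ | ⟨j, h3, h4, rfl⟩
        · rw [wdeg_single, wdeg_single, hwl] at huv
          rw [Nat.eq_of_mul_eq_mul_right hb0 huv]
        · rw [wdeg_single, wdeg_single, hwl, one_mul, hwi j h3 h4] at huv
          exact absurd huv.symm
            (add_ne_mul_of_PF hn hα hb0 hPF hb hbH h3 (by omega) hm (Or.inr h4))
        · rw [wdeg_single, wdeg_single, hwl, one_mul, hwi i h1 h2] at huv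
          exact absurd huv
            (add_ne_mul_of_PF hn hα hb0 hPF hb hbH h1 (by omega) hm' (Or.inr h2))
        · rw [wdeg_single, wdeg_single, one_mul, one_mul, hwi i h1 h2, hwi j h3 h4] at huv
          have : (i : ℕ) = j := Nat.eq_of_mul_eq_mul_right hα (by omega)
          rw [Fin.ext this]

end relMatrix

end Ideal

end NumSgp

theorem theorem3p7 {k : Type*} [Field k]
    (H : AddSubmonoid ℕ) (hH : NumSgp.IsNumericalSemigroup H)
    (n ℓ a h α b : ℕ) (hn : 3 ≤ n) (hℓ : 2 ≤ ℓ) (hα : 0 < α)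
    (ha : a = ℓ + n - 1) (hmult : NumSgp.mult H = a) (hdim : NumSgp.embDim H = n)
    -- `k[H] / (t ^ a)` is stretched
    (hstr : NumSgp.IsStretchedArtinianLocal
      (NumSgp.semigroupRing k H ⧸
        Ideal.span {NumSgp.tPow k H ⟨NumSgp.mult H, NumSgp.mult_mem hH⟩}))
    -- `PF(H) = {h + α, h + 2α, …, h + (n - 1)α}`
    (hPF : NumSgp.PF H = (fun i : ℕ => ((h + i * α : ℕ) : ℤ)) '' Set.Icc 1 (n - 1))
    -- `b = (h + (n - 1)α + a) / ℓ`
    (hb : ℓ * b = h + (n - 1) * α + a)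
    -- the case `j = n - 1`
    (hj : NumSgp.minimalGenerators H =
      {a, b} ∪ ((fun i : ℕ => h + i * α + a) '' Set.Icc 1 (n - 1) \ {h + (n - 1) * α + a})) :
    b + α ≡ 0 [MOD a] ∧
    h ≡ 0 [MOD a] ∧
    ∃ h₁ p : ℕ,
      h = h₁ * a ∧
      (p : ℚ) = ((b : ℚ) + α) / a ∧
      (p : ℚ) = ((h₁ : ℚ) + 1 + α) / ℓ ∧
      NumSgp.definingIdeal k (NumSgp.genTuple n a b h α) =
        NumSgp.minorsIdeal 2 (NumSgp.relMatrix k n (h₁ + 1) ℓ p) := by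
  have ha0 : 0 < a := by omega
  have haH : a ∈ H := (hj ▸ Or.inl (Or.inl rfl) : a ∈ NumSgp.minimalGenerators H).1
  have hbg : b ∈ NumSgp.minimalGenerators H := hj ▸ Or.inl (Or.inr rfl)
  have hbH : b ∈ H := hbg.1
  have hb0 : 0 < b := Nat.pos_of_ne_zero hbg.2.1
  have hcH : ∀ i, 1 ≤ i → i ≤ n - 1 → h + i * α + a ∈ H := fun i h1 h2 =>
    NumSgp.add_mem_of_PF hPF h1 h2 haH ha0
  have hmod := NumSgp.add_modEq_zero hH hn hℓ hα ha0 hb0 haH hbH hcH hPF hb hj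
  obtain ⟨p, hp⟩ := (Nat.modEq_zero_iff_dvd).1 hmod
  -- Both sides equal `ℓ(b + α)`; the equality `a = ℓ + n - 1` merges `(n-1)α` and `ℓα` into `aα`.
  have hsum : h + a * (1 + α) = a * (ℓ * p) := by
    have h1 : a = ℓ + (n - 1) := by omega
    calc h + a * (1 + α) = (h + (n - 1) * α + a) + ℓ * α := by
          rw [mul_add, mul_one]
          nth_rw 2 [h1]
          ring
      _ = ℓ * (b + α) := by rw [← hb, mul_add]
      _ = a * (ℓ * p) := by rw [hp]; ring
  have hdvd : a ∣ h := (Nat.dvd_add_left (dvd_mul_right a (1 + α))).1 (hsum ▸ dvd_mul_right _ _)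
  obtain ⟨h₁, hh⟩ := hdvd
  have hp' : h₁ + 1 + α = ℓ * p := by
    apply Nat.eq_of_mul_eq_mul_left ha0
    rw [← hsum, hh]
    ring
  have hq : (h₁ + 1) * a = h + a := by rw [hh]; ring
  refine ⟨hmod, Nat.modEq_zero_iff_dvd.2 ⟨h₁, hh⟩, h₁, p, by rw [hh, mul_comm], ?_, ?_, ?_⟩
  · rw [eq_div_iff (by positivity)]
    have : ((b + α : ℕ) : ℚ) = (a * p : ℕ) := congrArg _ hp
    push_cast at this
    rw [this, mul_comm]
  · rw [eq_div_iff (by positivity)]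
    have : ((h₁ + 1 + α : ℕ) : ℚ) = (ℓ * p : ℕ) := congrArg _ hp'
    push_cast at this
    rw [this, mul_comm]
  · exact le_antisymm
      (NumSgp.definingIdeal_le_minorsIdeal hn hα (by omega) ha0 hb0 haH hbH hcH hPF hb hq
        (by rw [hp, mul_comm]))
      (NumSgp.minorsIdeal_relMatrix_le hn hb hq (by rw [hp, mul_comm]))
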